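/- A seller offers $k$ items to a single buyer whose valuation is a random vector $x\in\mathbb{R}_+^k$ with known distribution $\mathcal F$. A mechanism is a pair $(q,s)$ of functions of $x\in\mathbb R_+^k$: the allocation probabilities $q(x)\in[0,1]^k$ and the (expected) payment $s(x)\in\mathbb{R}$ ($s$ measurable). It is incentive compatible (IC) if $x\cdot q(x)-s(x)\ge x\cdot q(y)-s(y)$ for all $x,y\in\mathbb{R}_+^k$, and individually rational (IR) if $x\cdot q(x)-s(x)\ge 0$ for all $x\in\mathbb{R}_+^k$; its revenue is $\mathbb{E}_{x\sim\mathcal F}[s(x)]$. For a probability distribution $F$ on $\mathbb{R}_+$, $\mathrm{Rev}(F)\in[0,\infty]$ is the supremum of the revenue over all IC and IR mechanisms for one item with value distributed according to $F$. For a distribution $\mathcal F$ on $\mathbb{R}_+^k$, $\mathrm{SRev}(\mathcal F)$ is the supremum of the revenue when each item $i$ is sold separately by some IC and IR one-item mechanism (applied to $x_i$), and $\mathrm{BRev}(\mathcal F)$ is the supremum of the revenue when all items are sold together as one bundle by some IC and IR one-item mechanism (applied to $x_1+\cdots+x_k$). Values of these quantities may be $+\infty$. (i) Let $w$ be the unique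 real solution of $we^w=1/e$, so that $1+w=1.278\ldots$. For all probability distributions $F_1,F_2$ on $\mathbb{R}_+$, $$\mathrm{BRev}(F_1\times F_2)\le (1+w)\bigl(\mathrm{Rev}(F_1)+\mathrm{Rev}(F_2)\bigr)=(1+w)\,\mathrm{SRev}(F_1\times F_2).$$ (ii) There is a constant $c>0$ such that for every integer $k\ge 2$ and all probability distributions $F_1,\dots,F_k$ on $\mathbb{R}_+$, $$\mathrm{BRev}(F_1\times\cdots\times F_k)\le c\log k\cdot\sum_{i=1}^k\mathrm{Rev}(F_i)=c\log k\cdot\mathrm{SRev}(F_1\times\cdots\times F_k),$$ where $\log$ is the natural logarithm. -/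

import Mathlib

open MeasureTheory
open scoped NNReal ENNReal

/-- A (direct) mechanism for selling `k` items to one additive, risk-neutral buyer whose valuation
is a vector `x` of `k` nonnegative reals: `q x i` is the probability that item `i` is allocated to
the buyer, and `s x` is the expected payment to the seller (of either sign). -/
structure Mechanism (k : ℕ) where
  q : (Fin k → ℝ≥0) → Fin k → ℝ
  s : (Fin k → ℝ≥0) → ℝ
  q_mem : ∀ x i, q x i ∈ Set.Icc (0 : ℝ) 1
  measurable_s : Measurable s

namespace Mechanism

/-- The utility of a buyer with valuation `x` who reports `y`. -/
def utility {k : ℕ} (m : Mechanism k) (x y : Fin k → ℝ≥0) : ℝ :=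
  ∑ i, (x i : ℝ) * m.q y i - m.s y

/-- Incentive compatibility: truthful reporting is optimal. -/
def IsIC {k : ℕ} (m : Mechanism k) : Prop := ∀ x y, m.utility x y ≤ m.utility x x

/-- (Ex-post) individual rationality: the truthful utility is nonnegative. -/
def IsIR {k : ℕ} (m : Mechanism k) : Prop := ∀ x, 0 ≤ m.utility x x

/-- The expected payment of the buyer when the valuation has law `μ`, with values in `[0, ∞]`:
the integral of the positive part of `s` minus that of the negative part. For an incentive
compatible mechanism `s ≥ s 0`, so for a probability measure `μ` the second integral is finite; a
negative expectation is truncated to `0`, which does not affect the suprema below, since the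
mechanism that never sells and never charges has revenue `0`. -/
noncomputable def revenue {k : ℕ} (m : Mechanism k) (μ : Measure (Fin k → ℝ≥0)) : ℝ≥0∞ :=
  (∫⁻ x, ENNReal.ofReal (m.s x) ∂μ) - ∫⁻ x, ENNReal.ofReal (-m.s x) ∂μ

/-- Selling the `k` items separately: item `i` is sold by the one-item mechanism `m i`. -/
def separate {k : ℕ} (m : Fin k → Mechanism 1) : Mechanism k where
  q x i := (m i).q (fun _ => x i) 0
  s x := ∑ i, (m i).s (fun _ => x i)
  q_mem _ i := (m i).q_mem _ 0
  measurable_s := Finset.measurable_sum _ fun i _ =>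
    (m i).measurable_s.comp (measurable_pi_lambda _ fun _ => measurable_pi_apply i)

/-- Selling the `k` items as one bundle, whose value to the buyer is `∑ i, x i`, by the one-item
mechanism `m`. -/
def bundle (k : ℕ) (m : Mechanism 1) : Mechanism k where
  q x _ := m.q (fun _ => ∑ j, x j) 0
  s x := m.s (fun _ => ∑ j, x j)
  q_mem _ _ := m.q_mem _ 0
  measurable_s := m.measurable_s.comp (measurable_pi_lambda _ fun _ =>
    Finset.measurable_sum _ fun j _ => measurable_pi_apply j)

end Mechanism

/-- The optimal revenue from `k` items with joint law `μ` of the valuation: the supremum over all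
incentive compatible and individually rational mechanisms. -/
noncomputable def Rev {k : ℕ} (μ : Measure (Fin k → ℝ≥0)) : ℝ≥0∞ :=
  ⨆ (m : Mechanism k) (_ : m.IsIC ∧ m.IsIR), m.revenue μ

/-- The optimal revenue from one item whose value has law `F`. -/
noncomputable def Rev₁ (F : Measure ℝ≥0) : ℝ≥0∞ :=
  Rev (F.map fun v (_ : Fin 1) => v)

/-- The maximal revenue obtainable by selling each item separately. -/
noncomputable def SRev {k : ℕ} (μ : Measure (Fin k → ℝ≥0)) : ℝ≥0∞ :=
  ⨆ (m : Fin k → Mechanism 1) (_ : ∀ i, (m i).IsIC ∧ (m i).IsIR),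
    (Mechanism.separate m).revenue μ

/-- The maximal revenue obtainable by bundling all items together. -/
noncomputable def BRev {k : ℕ} (μ : Measure (Fin k → ℝ≥0)) : ℝ≥0∞ :=
  ⨆ (m : Mechanism 1) (_ : m.IsIC ∧ m.IsIR), (Mechanism.bundle k m).revenue μ

/-!
By Myerson's theorem one item is best sold at a posted price, so the optimal revenue from a value
`X` is `⨆ p, p * ℙ(p ≤ X)`, the weak `L¹` quasi-norm of `X`. Separate sales earn the sum of the
quasi-norms and bundling earns the quasi-norm of the sum: both parts are quasi-triangle inequalities
for weak `L¹`. For `k` summands the constant is logarithmic by truncation, as in the lemma of Stein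
and Weiss. For two independent summands of quasi-norms `a` and `b`, conditioning on the first gives
`p * ℙ(p ≤ X + Y) ≤ a + b + a * b / p * (log ((p - a) / a) + log ((p - b) / b))`, and the tangent to
`log` at `1 / w`, which reads `log z ≤ w * (1 + z)` when `w * exp w = 1 / exp 1`, bounds the
right-hand side by `(1 + w) * (a + b)`.
-/

/-- The optimal revenue from offering one item, whose value has law `F`, at a posted price. -/
noncomputable def postedRev (F : Measure ℝ≥0) : ℝ≥0∞ :=
  ⨆ p : ℝ≥0, p * F (Set.Ici p)

theorem mul_measure_Ici_le_postedRev (F : Measure ℝ≥0) (p : ℝ≥0) :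
    p * F (Set.Ici p) ≤ postedRev F :=
  le_iSup (fun p : ℝ≥0 => (p : ℝ≥0∞) * F (Set.Ici p)) p

theorem measurable_const_fin_one : Measurable fun (v : ℝ≥0) (_ : Fin 1) => v :=
  measurable_pi_lambda _ fun _ => measurable_id

theorem measurable_sum_coord {k : ℕ} : Measurable fun x : Fin k → ℝ≥0 => ∑ i, x i :=
  Finset.measurable_sum _ fun i _ => measurable_pi_apply i

namespace Mechanism

/-- The allocation probability of a one-item mechanism, as a function of the value of the item. -/
def allocation (m : Mechanism 1) (v : ℝ≥0) : ℝ := m.q (fun _ => v) 0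

/-- The payment of a one-item mechanism, as a function of the value of the item. -/
def payment (m : Mechanism 1) (v : ℝ≥0) : ℝ := m.s fun _ => v

section OneItem

variable {m : Mechanism 1}

theorem measurable_payment (m : Mechanism 1) : Measurable m.payment :=
  m.measurable_s.comp measurable_const_fin_one

theorem utility_const (m : Mechanism 1) (x y : ℝ≥0) :
    m.utility (fun _ => x) (fun _ => y) = x * m.allocation y - m.payment y := by
  simp [utility, allocation, payment]

theorem IsIC.payment_sub_le (h : m.IsIC) (x y : ℝ≥0) :
    m.payment y - m.payment x ≤ y * (m.allocation y - m.allocation x) := by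
  have h_report := h (fun _ => y) (fun _ => x)
  rw [utility_const, utility_const] at h_report
  linarith

theorem IsIC.monotone_allocation (h : m.IsIC) : Monotone m.allocation := by
  intro x y hxy
  obtain rfl | hlt := hxy.eq_or_lt
  · exact le_rfl
  have h_mul : 0 ≤ ((y : ℝ) - x) * (m.allocation y - m.allocation x) := by
    linarith [h.payment_sub_le x y, h.payment_sub_le y x]
  exact sub_nonneg.1 (nonneg_of_mul_nonneg_right h_mul (sub_pos.2 hlt))

theorem IsIC.monotone_payment (h : m.IsIC) : Monotone m.payment := by
  intro x y hxy
  have h_nonneg : 0 ≤ x * (m.allocation y - m.allocation x) :=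
    mul_nonneg x.coe_nonneg (sub_nonneg.2 (h.monotone_allocation hxy))
  linarith [h.payment_sub_le y x]

theorem IsIR.payment_zero_nonpos (h : m.IsIR) : m.payment 0 ≤ 0 := by
  have h_zero := h fun _ => 0
  rw [utility_const] at h_zero
  simpa using h_zero

theorem IsIC.payment_sub_le_sum (h : m.IsIC) (p : ℕ → ℝ≥0) (n : ℕ) :
    m.payment (p n) - m.payment (p 0) ≤
      ∑ i ∈ Finset.range n, p (i + 1) * (m.allocation (p (i + 1)) - m.allocation (p i)) := by
  rw [← Finset.sum_range_sub fun i => m.payment (p i)]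
  exact Finset.sum_le_sum fun i _ => h.payment_sub_le (p i) (p (i + 1))

/-- The increment of the allocation probability between two consecutive multiples of `ε`. -/
def allocationStep (m : Mechanism 1) (ε : ℝ≥0) (i : ℕ) : ℝ :=
  m.allocation ((i + 1 : ℕ) * ε) - m.allocation (i * ε)

theorem IsIC.allocationStep_nonneg (h : m.IsIC) (ε : ℝ≥0) (i : ℕ) : 0 ≤ m.allocationStep ε i :=
  sub_nonneg.2 (h.monotone_allocation (by gcongr; exact i.le_succ))

theorem IsIC.tsum_allocationStep_le_one (h : m.IsIC) (ε : ℝ≥0) :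
    ∑' i, ENNReal.ofReal (m.allocationStep ε i) ≤ 1 := by
  refine ENNReal.tsum_le_of_sum_range_le fun n => ?_
  rw [← ENNReal.ofReal_sum_of_nonneg fun i _ => h.allocationStep_nonneg ε i]
  unfold allocationStep
  rw [Finset.sum_range_sub fun i : ℕ => m.allocation (i * ε), ENNReal.ofReal_le_one]
  have h_top : m.allocation (n * ε) ≤ 1 := (m.q_mem _ 0).2
  have h_bot : 0 ≤ m.allocation ((0 : ℕ) * ε) := (m.q_mem _ 0).1
  linarith

/-- Up to the mesh `ε`, the mechanism is a mixture of posted prices, in which the price `i * ε` has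
weight `m.allocationStep ε i`. -/
theorem IsIC.ofReal_payment_le_tsum (hic : m.IsIC) (hir : m.IsIR) {ε : ℝ≥0} (hε : 0 < ε)
    (x : ℝ≥0) :
    ENNReal.ofReal (m.payment x) ≤ ∑' i : ℕ, ENNReal.ofReal (m.allocationStep ε i) *
      (Set.Ici (i * ε)).indicator (fun _ => ((i * ε + ε : ℝ≥0) : ℝ≥0∞)) x := by
  set n := ⌊x / ε⌋₊
  have hnx : n * ε ≤ x := (le_div_iff₀ hε).1 (Nat.floor_le zero_le)
  have hxn : x ≤ (n + 1 : ℕ) * ε := by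
    rw [← div_le_iff₀ hε]
    exact_mod_cast (Nat.lt_floor_add_one (x / ε)).le
  have h_pay : m.payment x ≤
      ∑ i ∈ Finset.range (n + 1), m.allocationStep ε i * (i * ε + ε : ℝ≥0) := by
    have h_sum := hic.payment_sub_le_sum (fun i => i * ε) (n + 1)
    simp only [Nat.cast_zero, zero_mul] at h_sum
    calc m.payment x ≤ m.payment ((n + 1 : ℕ) * ε) := hic.monotone_payment hxn
      _ ≤ _ := by linarith [hir.payment_zero_nonpos]
      _ = _ := Finset.sum_congr rfl fun i _ => by
        rw [allocationStep, mul_comm]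
        push_cast
        ring
  calc ENNReal.ofReal (m.payment x)
      ≤ ∑ i ∈ Finset.range (n + 1), ENNReal.ofReal (m.allocationStep ε i * (i * ε + ε : ℝ≥0)) := by
        rw [← ENNReal.ofReal_sum_of_nonneg fun i _ =>
          mul_nonneg (hic.allocationStep_nonneg ε i) NNReal.zero_le_coe]
        exact ENNReal.ofReal_le_ofReal h_pay
    _ = ∑ i ∈ Finset.range (n + 1), ENNReal.ofReal (m.allocationStep ε i) *
          (Set.Ici (i * ε)).indicator (fun _ => ((i * ε + ε : ℝ≥0) : ℝ≥0∞)) x := by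
        refine Finset.sum_congr rfl fun i hi => ?_
        have hix : i * ε ≤ x :=
          hnx.trans' (by gcongr; exact Nat.lt_succ_iff.1 (Finset.mem_range.1 hi))
        rw [Set.indicator_of_mem (Set.mem_Ici.2 hix),
          ENNReal.ofReal_mul (hic.allocationStep_nonneg ε i), ENNReal.ofReal_coe_nnreal]
    _ ≤ _ := ENNReal.sum_le_tsum _

theorem IsIC.lintegral_payment_le_add (hic : m.IsIC) (hir : m.IsIR) (F : Measure ℝ≥0) {ε : ℝ≥0}
    (hε : 0 < ε) :
    ∫⁻ x, ENNReal.ofReal (m.payment x) ∂F ≤ postedRev F + ε * F Set.univ := by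
  have h_price : ∀ i : ℕ,
      ∫⁻ x, (Set.Ici (i * ε)).indicator (fun _ => ((i * ε + ε : ℝ≥0) : ℝ≥0∞)) x ∂F ≤
        postedRev F + ε * F Set.univ := fun i => by
    rw [lintegral_indicator_const measurableSet_Ici, ENNReal.coe_add, add_mul]
    gcongr
    · exact mul_measure_Ici_le_postedRev F _
    · exact Set.subset_univ _
  calc ∫⁻ x, ENNReal.ofReal (m.payment x) ∂F
      ≤ ∫⁻ x, ∑' i : ℕ, ENNReal.ofReal (m.allocationStep ε i) *
          (Set.Ici (i * ε)).indicator (fun _ => ((i * ε + ε : ℝ≥0) : ℝ≥0∞)) x ∂F :=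
        lintegral_mono (hic.ofReal_payment_le_tsum hir hε)
    _ = ∑' i : ℕ, ENNReal.ofReal (m.allocationStep ε i) *
          ∫⁻ x, (Set.Ici (i * ε)).indicator (fun _ => ((i * ε + ε : ℝ≥0) : ℝ≥0∞)) x ∂F := by
        have h_meas (i : ℕ) : Measurable
            ((Set.Ici (i * ε)).indicator fun _ : ℝ≥0 => ((i * ε + ε : ℝ≥0) : ℝ≥0∞)) :=
          measurable_const.indicator measurableSet_Ici
        rw [lintegral_tsum fun i => ((h_meas i).const_mul _).aemeasurable]
        exact tsum_congr fun i => lintegral_const_mul _ (h_meas i)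
    _ ≤ ∑' i : ℕ, ENNReal.ofReal (m.allocationStep ε i) * (postedRev F + ε * F Set.univ) :=
        ENNReal.tsum_le_tsum fun i => by gcongr; exact h_price i
    _ ≤ postedRev F + ε * F Set.univ := by
        rw [ENNReal.tsum_mul_right]
        exact mul_le_of_le_one_left zero_le (hic.tsum_allocationStep_le_one ε)

theorem IsIC.lintegral_payment_le_postedRev (hic : m.IsIC) (hir : m.IsIR) (F : Measure ℝ≥0)
    [IsFiniteMeasure F] : ∫⁻ x, ENNReal.ofReal (m.payment x) ∂F ≤ postedRev F := by
  refine ENNReal.le_of_forall_pos_le_add fun δ hδ _ => ?_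
  obtain ⟨ε, hε, hεδ⟩ :=
    ENNReal.exists_nnreal_pos_mul_lt (measure_ne_top F Set.univ) (ENNReal.coe_pos.2 hδ).ne'
  exact (hic.lintegral_payment_le_add hir F hε).trans (by gcongr)

end OneItem

section Posted

/-- Offering one item at the posted price `p`. -/
noncomputable def posted (p : ℝ≥0) : Mechanism 1 where
  q x _ := if p ≤ x 0 then 1 else 0
  s x := if p ≤ x 0 then p else 0
  q_mem x _ := by split_ifs <;> simp
  measurable_s := Measurable.ite (measurableSet_le measurable_const (measurable_pi_apply 0))
    measurable_const measurable_const

theorem utility_posted (p : ℝ≥0) (x y : Fin 1 → ℝ≥0) :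
    (posted p).utility x y = if p ≤ y 0 then (x 0 : ℝ) - p else 0 := by
  by_cases h : p ≤ y 0 <;> simp [utility, posted, h]

theorem isIC_posted (p : ℝ≥0) : (posted p).IsIC := by
  intro x y
  simp only [utility_posted, ← NNReal.coe_le_coe]
  split_ifs <;> linarith

theorem isIR_posted (p : ℝ≥0) : (posted p).IsIR := by
  intro x
  simp only [utility_posted, ← NNReal.coe_le_coe]
  split_ifs <;> linarith

theorem posted_s_nonneg (p : ℝ≥0) (x : Fin 1 → ℝ≥0) : 0 ≤ (posted p).s x := by
  simp only [posted]
  split_ifs <;> simp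

theorem lintegral_payment_posted (p : ℝ≥0) (F : Measure ℝ≥0) :
    ∫⁻ x, ENNReal.ofReal ((posted p).payment x) ∂F = p * F (Set.Ici p) := by
  rw [← lintegral_indicator_const measurableSet_Ici]
  refine lintegral_congr fun x => ?_
  by_cases h : p ≤ x <;> simp [posted, payment, h]

end Posted

section Revenue

variable {k : ℕ}

theorem revenue_eq_lintegral_of_nonneg {m : Mechanism k} (h : ∀ x, 0 ≤ m.s x)
    (μ : Measure (Fin k → ℝ≥0)) : m.revenue μ = ∫⁻ x, ENNReal.ofReal (m.s x) ∂μ := by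
  simp [revenue, ENNReal.ofReal_of_nonpos (neg_nonpos.2 (h _))]

theorem revenue_bundle (m : Mechanism 1) (μ : Measure (Fin k → ℝ≥0)) :
    (bundle k m).revenue μ =
      m.revenue ((μ.map fun x => ∑ i, x i).map fun v (_ : Fin 1) => v) := by
  rw [Measure.map_map measurable_const_fin_one measurable_sum_coord, revenue, revenue,
    lintegral_map m.measurable_s.ennreal_ofReal
      (measurable_const_fin_one.comp measurable_sum_coord),
    lintegral_map (f := fun x => ENNReal.ofReal (-m.s x)) m.measurable_s.neg.ennreal_ofReal
      (measurable_const_fin_one.comp measurable_sum_coord)]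
  rfl

theorem lintegral_sum_payment (m : Fin k → Mechanism 1) (μ : Measure (Fin k → ℝ≥0)) :
    ∫⁻ x, ∑ i, ENNReal.ofReal ((m i).payment (x i)) ∂μ =
      ∑ i, ∫⁻ v, ENNReal.ofReal ((m i).payment v) ∂μ.map fun x => x i := by
  have h_meas (i : Fin k) : Measurable fun v => ENNReal.ofReal ((m i).payment v) :=
    (m i).measurable_payment.ennreal_ofReal
  rw [lintegral_finsetSum (f := fun i (x : Fin k → ℝ≥0) => ENNReal.ofReal ((m i).payment (x i)))
    _ fun i _ => (h_meas i).comp (measurable_pi_apply i)]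
  exact Finset.sum_congr rfl fun i _ => (lintegral_map (h_meas i) (measurable_pi_apply i)).symm

theorem revenue_separate_le (m : Fin k → Mechanism 1) (μ : Measure (Fin k → ℝ≥0)) :
    (separate m).revenue μ ≤
      ∑ i, ∫⁻ v, ENNReal.ofReal ((m i).payment v) ∂μ.map fun x => x i := by
  rw [← lintegral_sum_payment]
  exact tsub_le_self.trans (lintegral_mono fun x => Finset.le_sum_of_subadditive _
    ENNReal.ofReal_zero.le (fun _ _ => ENNReal.ofReal_add_le) _ _)

theorem revenue_separate_posted (p : Fin k → ℝ≥0) (μ : Measure (Fin k → ℝ≥0)) :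
    (separate fun i => posted (p i)).revenue μ =
      ∑ i, p i * (μ.map fun x => x i) (Set.Ici (p i)) := by
  have h_nonneg (x : Fin k → ℝ≥0) : 0 ≤ (separate fun i => posted (p i)).s x :=
    Finset.sum_nonneg (s := .univ) (f := fun i => (posted (p i)).payment (x i)) fun i _ =>
      posted_s_nonneg (p i) _
  simp_rw [revenue_eq_lintegral_of_nonneg h_nonneg, ← lintegral_payment_posted,
    ← lintegral_sum_payment]
  exact lintegral_congr fun x => ENNReal.ofReal_sum_of_nonneg (s := .univ)
    (f := fun i => (posted (p i)).payment (x i)) fun i _ => posted_s_nonneg (p i) _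

end Revenue

end Mechanism

open Mechanism

theorem Rev₁_eq_postedRev (F : Measure ℝ≥0) [IsFiniteMeasure F] : Rev₁ F = postedRev F := by
  refine le_antisymm (iSup₂_le fun m hm => tsub_le_self.trans ?_) (iSup_le fun p => ?_)
  · rw [lintegral_map m.measurable_s.ennreal_ofReal measurable_const_fin_one]
    exact hm.1.lintegral_payment_le_postedRev hm.2 F
  · refine le_iSup₂_of_le (posted p) ⟨isIC_posted p, isIR_posted p⟩ ?_
    rw [revenue_eq_lintegral_of_nonneg (posted_s_nonneg p),
      lintegral_map (posted p).measurable_s.ennreal_ofReal measurable_const_fin_one]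
    exact (lintegral_payment_posted p F).ge

theorem BRev_eq_Rev₁_map_sum {k : ℕ} (μ : Measure (Fin k → ℝ≥0)) :
    BRev μ = Rev₁ (μ.map fun x => ∑ i, x i) := by
  simp only [BRev, Rev₁, Rev, revenue_bundle]

theorem sum_iSup_eq_iSup_sum {ι α : Type*} [Fintype ι] [Nonempty α]
    (f : ι → α → ℝ≥0∞) :
    ∑ i, ⨆ a, f i a = ⨆ g : ι → α, ∑ i, f i (g i) := by
  classical
  rw [← ENNReal.finsetSum_iSup fun g g' => ⟨fun i =>
    if f i (g i) ≤ f i (g' i) then g' i else g i, by grind⟩]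
  have h_surj (i : ι) : Function.Surjective fun g : ι → α => g i := Function.surjective_eval i
  exact Finset.sum_congr rfl fun i _ => ((h_surj i).iSup_comp (f i)).symm

theorem SRev_eq_sum_Rev₁ {k : ℕ} (μ : Measure (Fin k → ℝ≥0)) [IsFiniteMeasure μ] :
    SRev μ = ∑ i, Rev₁ (μ.map fun x => x i) := by
  simp_rw [Rev₁_eq_postedRev]
  refine le_antisymm (iSup₂_le fun m hm => (revenue_separate_le m μ).trans ?_) ?_
  · exact Finset.sum_le_sum fun i _ => (hm i).1.lintegral_payment_le_postedRev (hm i).2 _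
  · simp_rw [postedRev, sum_iSup_eq_iSup_sum]
    refine iSup_le fun p => le_iSup₂_of_le (fun i => posted (p i))
      (fun i => ⟨isIC_posted _, isIR_posted _⟩) (revenue_separate_posted p μ).ge

section WeakL1

variable {Ω : Type*} [MeasurableSpace Ω] {μ : Measure Ω}

/-- The weak `L¹` quasi-norm of the positive part of `X` is at most `a`: if `X` is the value of an
item, then no posted price earns more than `a`. -/
def HasWeakL1Bound (X : Ω → ℝ) (a : ℝ) (μ : Measure Ω) : Prop :=
  ∀ t, 0 < t → t * μ.real {ω | t ≤ X ω} ≤ a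

theorem HasWeakL1Bound.measureReal_le_div {X : Ω → ℝ} {a t : ℝ} (h : HasWeakL1Bound X a μ)
    (ht : 0 < t) : μ.real {ω | t ≤ X ω} ≤ a / t :=
  (le_div_iff₀' ht).2 (h t ht)

theorem postedRev_map_le_iff [IsFiniteMeasure μ] {X : Ω → ℝ≥0} (hX : Measurable X) {a : ℝ≥0} :
    postedRev (μ.map X) ≤ a ↔ HasWeakL1Bound (fun ω => (X ω : ℝ)) a μ := by
  have h_price (p : ℝ≥0) : p * (μ.map X) (Set.Ici p) ≤ a ↔ p * μ.real {ω | (p : ℝ) ≤ X ω} ≤ a := by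
    rw [Measure.map_apply hX measurableSet_Ici, ← ENNReal.toReal_le_toReal
      (ENNReal.mul_ne_top ENNReal.coe_ne_top (measure_ne_top _ _)) ENNReal.coe_ne_top,
      ENNReal.toReal_mul]
    simp [Measure.real, Set.preimage, NNReal.coe_le_coe]
  simp only [postedRev, iSup_le_iff, h_price]
  refine ⟨fun h t ht => h ⟨t, ht.le⟩, fun h p => ?_⟩
  obtain rfl | hp := eq_zero_or_pos p
  · simp
  · exact h p hp

theorem integral_le_add_integral_of_tail_le [IsProbabilityMeasure μ] {f : Ω → ℝ} {g : ℝ → ℝ}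
    {u v : ℝ} (hu : 0 ≤ u) (huv : u ≤ v) (hf : AEMeasurable f μ) (hf_nonneg : ∀ ω, 0 ≤ f ω)
    (hf_le : ∀ ω, f ω ≤ v) (hg : IntervalIntegrable g volume u v)
    (h_tail : ∀ t ∈ Set.Ioo u v, μ.real {ω | t ≤ f ω} ≤ g t) :
    ∫ ω, f ω ∂μ ≤ u + ∫ t in u..v, g t := by
  have hf_int : Integrable f μ := Integrable.of_bound hf.aestronglyMeasurable v
    (.of_forall fun ω => by simpa only [Real.norm_of_nonneg (hf_nonneg ω)] using hf_le ω)
  have h_anti : Antitone fun t => μ.real {ω | t ≤ f ω} := fun s t hst =>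
    measureReal_mono fun ω hω => hst.trans hω
  calc ∫ ω, f ω ∂μ = ∫ t in (0 : ℝ)..v, μ.real {ω | t ≤ f ω} := by
        rw [hf_int.integral_eq_integral_Ioc_meas_le (.of_forall hf_nonneg) (.of_forall hf_le),
          intervalIntegral.integral_of_le (hu.trans huv)]
    _ = (∫ t in (0 : ℝ)..u, μ.real {ω | t ≤ f ω}) + ∫ t in u..v, μ.real {ω | t ≤ f ω} :=
        (intervalIntegral.integral_add_adjacent_intervals h_anti.intervalIntegrable
          h_anti.intervalIntegrable).symm
    _ ≤ (∫ _ in (0 : ℝ)..u, 1) + ∫ t in u..v, g t := by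
        gcongr
        · exact intervalIntegral.integral_mono hu h_anti.intervalIntegrable
            intervalIntegrable_const fun t => measureReal_le_one
        · exact intervalIntegral.integral_mono_on_of_le_Ioo huv h_anti.intervalIntegrable hg h_tail
    _ = u + ∫ t in u..v, g t := by simp

theorem HasWeakL1Bound.integral_max_min_le [IsProbabilityMeasure μ] {X : Ω → ℝ} {a c p : ℝ}
    (hX : AEMeasurable X μ) (h : HasWeakL1Bound X a μ) (hc : 0 < c) (hcp : c ≤ p) :
    ∫ ω, max c (min (X ω) p) ∂μ ≤ c + a * Real.log (p / c) := by
  have h_pos : ∀ t ∈ Set.uIcc c p, 0 < t := fun t ht => hc.trans_le (by simp_all)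
  have h_int : ∫ t in c..p, a / t = a * Real.log (p / c) := by
    simp only [div_eq_mul_inv a, intervalIntegral.integral_const_mul]
    rw [integral_inv_of_pos hc (hc.trans_le hcp)]
  rw [← h_int]
  refine integral_le_add_integral_of_tail_le hc.le hcp (by fun_prop)
    (fun ω => hc.le.trans (le_max_left _ _)) (fun ω => max_le hcp (min_le_right _ _))
    (ContinuousOn.intervalIntegrable <| continuousOn_const.div continuousOn_id fun t ht =>
      (h_pos t ht).ne') fun t ht => ?_
  refine (measureReal_mono fun ω hω => ?_).trans (h.measureReal_le_div (hc.trans ht.1))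
  exact ((le_max_iff.1 hω).resolve_left (not_le.2 ht.1)).trans (min_le_left _ _)

section Sum

variable {ι : Type*} [Fintype ι] {X : ι → Ω → ℝ} {a : ι → ℝ}

theorem measureReal_exists_le_le_sum_div (h : ∀ i, HasWeakL1Bound (X i) (a i) μ) {p : ℝ}
    (hp : 0 < p) : μ.real {ω | ∃ i, p ≤ X i ω} ≤ (∑ i, a i) / p := by
  rw [Set.ofPred_exists, Finset.sum_div]
  exact (measureReal_iUnion_fintype_le _).trans
    (Finset.sum_le_sum fun i _ => (h i).measureReal_le_div hp)

theorem measureReal_le_sum_truncation_le [IsProbabilityMeasure μ] (hX : ∀ i, AEMeasurable (X i) μ)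
    (h : ∀ i, HasWeakL1Bound (X i) (a i) μ) {c p r : ℝ} (hc : 0 < c) (hcp : c ≤ p) (hr : 0 < r) :
    μ.real {ω | r ≤ ∑ i, (max c (min (X i ω) p) - c)} ≤
      (∑ i, a i) * Real.log (p / c) / r := by
  have h_int (i : ι) : Integrable (fun ω => max c (min (X i ω) p)) μ := by
    have h_meas : AEMeasurable (fun ω => max c (min (X i ω) p)) μ := by fun_prop
    refine Integrable.of_bound h_meas.aestronglyMeasurable p (.of_forall fun ω => ?_)
    rw [Real.norm_of_nonneg (hc.le.trans (le_max_left _ _))]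
    exact max_le hcp (min_le_right _ _)
  have h_int_sub (i : ι) : Integrable (fun ω => max c (min (X i ω) p) - c) μ :=
    (h_int i).sub (integrable_const c)
  rw [le_div_iff₀' hr]
  calc r * μ.real {ω | r ≤ ∑ i, (max c (min (X i ω) p) - c)}
      ≤ ∫ ω, ∑ i, (max c (min (X i ω) p) - c) ∂μ :=
        mul_meas_ge_le_integral_of_nonneg (.of_forall fun ω => Finset.sum_nonneg fun i _ =>
          sub_nonneg.2 (le_max_left _ _)) (integrable_finsetSum _ fun i _ => h_int_sub i) r
    _ = ∑ i, (∫ ω, max c (min (X i ω) p) ∂μ - c) := by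
        rw [integral_finsetSum _ fun i _ => h_int_sub i]
        exact Finset.sum_congr rfl fun i _ => by
          rw [integral_sub (h_int i) (integrable_const c), integral_const, probReal_univ, one_smul]
    _ ≤ ∑ i, a i * Real.log (p / c) := Finset.sum_le_sum fun i _ =>
        sub_le_iff_le_add'.2 ((h i).integral_max_min_le (hX i) hc hcp)
    _ = (∑ i, a i) * Real.log (p / c) := (Finset.sum_mul ..).symm

/-- The sum reaches `p` only if some summand does or the truncations to `[p / 2n, p]` contribute at
least `p / 2` above their floor; the logarithm is the mean of a truncation. -/
theorem HasWeakL1Bound.sum [IsProbabilityMeasure μ] [Nonempty ι] (hX : ∀ i, AEMeasurable (X i) μ)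
    (h : ∀ i, HasWeakL1Bound (X i) (a i) μ) :
    HasWeakL1Bound (fun ω => ∑ i, X i ω)
      ((1 + 2 * Real.log (2 * Fintype.card ι)) * ∑ i, a i) μ := by
  intro p hp
  have hn : (1 : ℝ) ≤ Fintype.card ι := by exact_mod_cast Fintype.card_pos
  set n : ℝ := (Fintype.card ι : ℝ) with hn_def
  set c : ℝ := p / (2 * n) with hc_def
  have hc : 0 < c := by positivity
  have hcp : c ≤ p := div_le_self hp.le (by linarith)
  have h_sub : {ω | p ≤ ∑ i, X i ω} ⊆
      {ω | ∃ i, p ≤ X i ω} ∪ {ω | p / 2 ≤ ∑ i, (max c (min (X i ω) p) - c)} := by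
    intro ω hω
    refine or_iff_not_imp_left.2 fun h_lt => ?_
    have h_floor : ∑ _ : ι, c = p / 2 := by
      rw [Finset.sum_const, Finset.card_univ, nsmul_eq_mul, hc_def, ← hn_def]
      field_simp
    have h_le : ∑ i, X i ω ≤ ∑ i, max c (min (X i ω) p) := Finset.sum_le_sum fun i _ => by
      rw [min_eq_left (not_le.1 fun hi => h_lt ⟨i, hi⟩).le]
      exact le_max_right _ _
    rw [Set.mem_ofPred_eq, Finset.sum_sub_distrib, h_floor]
    linarith [Set.mem_ofPred.1 hω]
  have h_ratio : p / c = 2 * n := by rw [hc_def]; field_simp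
  calc p * μ.real {ω | p ≤ ∑ i, X i ω}
      ≤ p * ((∑ i, a i) / p + (∑ i, a i) * Real.log (p / c) / (p / 2)) := by
        gcongr
        exact (measureReal_mono h_sub).trans <| (measureReal_union_le _ _).trans <|
          add_le_add (measureReal_exists_le_le_sum_div h hp)
            (measureReal_le_sum_truncation_le hX h hc hcp (half_pos hp))
    _ = (1 + 2 * Real.log (2 * n)) * ∑ i, a i := by
        rw [h_ratio]
        field_simp

end Sum

section Independent

open ProbabilityTheory

variable {X Y : Ω → ℝ} {a b p : ℝ}

theorem measureReal_le_add_eq_integral [IsFiniteMeasure μ] (hX : Measurable X) (hY : Measurable Y)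
    (hXY : X ⟂ᵢ[μ] Y) (p : ℝ) :
    μ.real {ω | p ≤ X ω + Y ω} = ∫ ω, μ.real {ω' | p - X ω ≤ Y ω'} ∂μ := by
  have h_meas : MeasurableSet {z : ℝ × ℝ | p ≤ z.1 + z.2} :=
    measurableSet_le measurable_const (by fun_prop)
  have h_section (x : ℝ) :
      μ.map Y (Prod.mk x ⁻¹' {z | p ≤ z.1 + z.2}) = μ {ω' | p - x ≤ Y ω'} := by
    rw [Measure.map_apply hY (measurable_prodMk_left h_meas)]
    simp only [Set.preimage, Set.mem_ofPred_eq, sub_le_iff_le_add']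
  have h_tail : Measurable fun x => μ {ω' | p - x ≤ Y ω'} :=
    Monotone.measurable fun x y hxy => measure_mono fun ω hω => (sub_le_sub_left hxy p).trans hω
  have h_lintegral : μ {ω | p ≤ X ω + Y ω} = ∫⁻ ω, μ {ω' | p - X ω ≤ Y ω'} ∂μ := calc
    μ {ω | p ≤ X ω + Y ω} = (μ.map fun ω => (X ω, Y ω)) {z | p ≤ z.1 + z.2} :=
        (Measure.map_apply (hX.prodMk hY) h_meas).symm
    _ = ∫⁻ x, μ {ω' | p - x ≤ Y ω'} ∂μ.map X := by
        rw [(indepFun_iff_map_prod_eq_prod_map_map hX.aemeasurable hY.aemeasurable).1 hXY,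
          Measure.prod_apply h_meas]
        simp_rw [h_section]
    _ = ∫⁻ ω, μ {ω' | p - X ω ≤ Y ω'} ∂μ := lintegral_map h_tail hX
  rw [measureReal_def, h_lintegral]
  exact (integral_toReal (h_tail.comp hX).aemeasurable
    (.of_forall fun _ => measure_lt_top _ _)).symm

theorem HasWeakL1Bound.measureReal_le_div_max [IsProbabilityMeasure μ] (h : HasWeakL1Bound Y b μ)
    (hb : 0 < b) (t : ℝ) : μ.real {ω | t ≤ Y ω} ≤ b / max t b := by
  rcases le_total t b with htb | hbt
  · rw [max_eq_right htb, div_self hb.ne']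
    exact measureReal_le_one
  · rw [max_eq_left hbt]
    exact h.measureReal_le_div (hb.trans_le hbt)

theorem HasWeakL1Bound.measureReal_le_div_max_sub_le [IsFiniteMeasure μ]
    (h : HasWeakL1Bound X a μ) (hb : 0 < b) {t : ℝ} (ht : 0 < t) (hbt : b < p * t) :
    μ.real {ω | t ≤ b / max (p - X ω) b} ≤ a / (p - b / t) := by
  refine (measureReal_mono fun ω hω => ?_).trans
    (h.measureReal_le_div (sub_pos.2 ((div_lt_iff₀ ht).2 hbt)))
  have h_max : max (p - X ω) b ≤ b / t :=
    (le_div_comm₀ ht (hb.trans_le (le_max_right _ _))).1 hω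
  exact sub_le_comm.1 ((le_max_left _ _).trans h_max)

theorem lt_mul_of_div_sub_le (ha : 0 < a) (hb : 0 < b) (hp : a + b < p) {t : ℝ}
    (ht : b / (p - a) ≤ t) : b < p * t := by
  have hpa : 0 < p - a := by linarith
  have ht_pos : 0 < t := (div_pos hb hpa).trans_le ht
  linarith [(div_le_iff₀' hpa).1 ht, mul_pos ha ht_pos]

theorem hasDerivAt_mul_add_mul_log_sub {t : ℝ} (hp : p ≠ 0) (ht : t ≠ 0) (hbt : p * t - b ≠ 0) :
    HasDerivAt (fun t => a / p * t + a * b / p ^ 2 * Real.log (p * t - b)) (a / (p - b / t)) t := by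
  have h_lin : HasDerivAt (fun t => p * t - b) p t := by
    simpa using ((hasDerivAt_id t).const_mul p).sub_const b
  have h_sum := ((hasDerivAt_id t).const_mul (a / p)).add
    ((h_lin.log hbt).const_mul (a * b / p ^ 2))
  refine h_sum.congr_deriv ?_
  have h_den : p - b / t = (p * t - b) / t := by field_simp
  rw [h_den]
  field_simp
  ring

theorem intervalIntegrable_div_sub_div (ha : 0 < a) (hb : 0 < b) (hp : a + b < p) :
    IntervalIntegrable (fun t => a / (p - b / t)) volume (b / (p - a)) 1 := by
  have hu : 0 < b / (p - a) := div_pos hb (by linarith)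
  have hu_le : b / (p - a) ≤ 1 := (div_le_one (by linarith)).2 (by linarith)
  have h_pos {t : ℝ} (ht : t ∈ Set.uIcc (b / (p - a)) 1) : 0 < t ∧ b / (p - a) ≤ t := by
    rw [Set.uIcc_of_le hu_le] at ht
    exact ⟨hu.trans_le ht.1, ht.1⟩
  refine ContinuousOn.intervalIntegrable <| continuousOn_const.div
    (continuousOn_const.sub <| continuousOn_const.div continuousOn_id fun t ht => (h_pos ht).1.ne')
    fun t ht => (sub_pos.2 <| (div_lt_iff₀ (h_pos ht).1).2 ?_).ne'
  exact lt_mul_of_div_sub_le ha hb hp (h_pos ht).2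

theorem mul_add_integral_div_sub_div (ha : 0 < a) (hb : 0 < b) (hp : a + b < p) :
    p * (b / (p - a) + ∫ t in b / (p - a)..1, a / (p - b / t)) =
      a + b + a * b / p * (Real.log ((p - a) / a) + Real.log ((p - b) / b)) := by
  have hp0 : 0 < p := by linarith
  have hpa : 0 < p - a := by linarith
  have hpb : 0 < p - b := by linarith
  have hu_le : b / (p - a) ≤ 1 := (div_le_one hpa).2 (by linarith)
  have h_deriv : ∀ t ∈ Set.uIcc (b / (p - a)) 1, HasDerivAt
      (fun t => a / p * t + a * b / p ^ 2 * Real.log (p * t - b)) (a / (p - b / t)) t := by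
    intro t ht
    rw [Set.uIcc_of_le hu_le] at ht
    exact hasDerivAt_mul_add_mul_log_sub hp0.ne' ((div_pos hb hpa).trans_le ht.1).ne'
      (sub_pos.2 (lt_mul_of_div_sub_le ha hb hp ht.1)).ne'
  have h_end : p * (b / (p - a)) - b = a * b / (p - a) := by
    field_simp
    ring
  rw [intervalIntegral.integral_eq_sub_of_hasDerivAt h_deriv
      (intervalIntegrable_div_sub_div ha hb hp), h_end, Real.log_div hpa.ne' ha.ne',
    Real.log_div hpb.ne' hb.ne', Real.log_div (by positivity) hpa.ne',
    Real.log_mul ha.ne' hb.ne', mul_one]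
  field_simp
  ring

/-- Given `X`, the sum reaches `p` with probability at most `b / max (p - X) b`; the mean of this
is bounded by integrating its tail. -/
theorem HasWeakL1Bound.mul_measureReal_le_add_le [IsProbabilityMeasure μ] (hX : Measurable X)
    (hY : Measurable Y) (hXY : X ⟂ᵢ[μ] Y) (hXa : HasWeakL1Bound X a μ) (hYb : HasWeakL1Bound Y b μ)
    (ha : 0 < a) (hb : 0 < b) (hp : a + b < p) :
    p * μ.real {ω | p ≤ X ω + Y ω} ≤
      a + b + a * b / p * (Real.log ((p - a) / a) + Real.log ((p - b) / b)) := by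
  have hu : 0 < b / (p - a) := div_pos hb (by linarith)
  have hu_le : b / (p - a) ≤ 1 := (div_le_one (by linarith)).2 (by linarith)
  have h_nonneg (ω : Ω) : 0 ≤ b / max (p - X ω) b := by positivity
  have h_le_one (ω : Ω) : b / max (p - X ω) b ≤ 1 :=
    (div_le_one (hb.trans_le (le_max_right _ _))).2 (le_max_right _ _)
  have h_meas : Measurable fun ω => b / max (p - X ω) b := by fun_prop
  rw [← mul_add_integral_div_sub_div ha hb hp, measureReal_le_add_eq_integral hX hY hXY]
  refine mul_le_mul_of_nonneg_left ?_ (by linarith)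
  calc ∫ ω, μ.real {ω' | p - X ω ≤ Y ω'} ∂μ
      ≤ ∫ ω, b / max (p - X ω) b ∂μ :=
        integral_mono_of_nonneg (.of_forall fun _ => measureReal_nonneg)
          (.of_bound h_meas.aestronglyMeasurable 1 (.of_forall fun ω => by
            simpa only [Real.norm_of_nonneg (h_nonneg ω)] using h_le_one ω))
          (.of_forall fun ω => hYb.measureReal_le_div_max hb _)
    _ ≤ b / (p - a) + ∫ t in b / (p - a)..1, a / (p - b / t) :=
        integral_le_add_integral_of_tail_le hu.le hu_le h_meas.aemeasurable h_nonneg h_le_one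
          (intervalIntegrable_div_sub_div ha hb hp) fun t ht =>
          hXa.measureReal_le_div_max_sub_le hb (hu.trans ht.1)
            (lt_mul_of_div_sub_le ha hb hp ht.1.le)

theorem pos_of_mul_exp_eq {w : ℝ} (hw : w * Real.exp w = 1 / Real.exp 1) : 0 < w :=
  (mul_pos_iff_of_pos_right (Real.exp_pos w)).1 (hw ▸ by positivity)

theorem log_le_of_mul_exp_eq {w z : ℝ} (hw : w * Real.exp w = 1 / Real.exp 1) (hz : 0 < z) :
    Real.log z ≤ w * (1 + z) := by
  have hw_pos : 0 < w := pos_of_mul_exp_eq hw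
  have h_log : Real.log w + w = -1 := by
    have h := congrArg Real.log hw
    rwa [Real.log_mul hw_pos.ne' (Real.exp_pos _).ne', Real.log_exp, one_div, Real.log_inv,
      Real.log_exp] at h
  have h_tangent := Real.log_le_sub_one_of_pos (mul_pos hw_pos hz)
  rw [Real.log_mul hw_pos.ne' hz.ne'] at h_tangent
  linarith

theorem HasWeakL1Bound.add_of_indepFun [IsProbabilityMeasure μ] {w : ℝ}
    (hw : w * Real.exp w = 1 / Real.exp 1) (hX : Measurable X) (hY : Measurable Y)
    (hXY : X ⟂ᵢ[μ] Y) (hXa : HasWeakL1Bound X a μ) (hYb : HasWeakL1Bound Y b μ) (ha : 0 < a)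
    (hb : 0 < b) : HasWeakL1Bound (fun ω => X ω + Y ω) ((w + 1) * (a + b)) μ := by
  intro p hp
  have hw_pos : 0 < w := pos_of_mul_exp_eq hw
  rcases le_or_gt p (a + b) with hp_le | hp_lt
  · calc p * μ.real {ω | p ≤ X ω + Y ω} ≤ p := mul_le_of_le_one_right hp.le measureReal_le_one
      _ ≤ a + b := hp_le
      _ ≤ (w + 1) * (a + b) := le_mul_of_one_le_left (by positivity) (by linarith)
  · have h_log_a := log_le_of_mul_exp_eq hw (div_pos (by linarith : 0 < p - a) ha)
    have h_log_b := log_le_of_mul_exp_eq hw (div_pos (by linarith : 0 < p - b) hb)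
    calc p * μ.real {ω | p ≤ X ω + Y ω}
        ≤ a + b + a * b / p * (Real.log ((p - a) / a) + Real.log ((p - b) / b)) :=
          hXa.mul_measureReal_le_add_le hX hY hXY hYb ha hb hp_lt
      _ ≤ a + b + a * b / p * (w * (1 + (p - a) / a) + w * (1 + (p - b) / b)) := by gcongr
      _ = (w + 1) * (a + b) := by
          field_simp
          ring

end Independent

end WeakL1

section Lambert

theorem strictMonoOn_mul_exp : StrictMonoOn (fun w : ℝ => w * Real.exp w) (Set.Ici 0) :=
  fun _ hv _ _ hvw => mul_lt_mul'' hvw (Real.exp_lt_exp.2 hvw) hv (Real.exp_pos _).le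

theorem existsUnique_mul_exp_eq {y : ℝ} (hy : 0 ≤ y) : ∃! w : ℝ, w * Real.exp w = y := by
  have h_mem : y ∈ Set.Icc (0 * Real.exp 0) (y * Real.exp y) :=
    ⟨by simpa using hy, le_mul_of_one_le_right hy (Real.one_le_exp hy)⟩
  obtain ⟨w, hw_mem, hw⟩ := intermediate_value_Icc (f := fun w : ℝ => w * Real.exp w) hy
    (by fun_prop) h_mem
  refine ⟨w, hw, fun v hv => strictMonoOn_mul_exp.injOn ?_ hw_mem.1 (hv.trans hw.symm)⟩
  exact (mul_nonneg_iff_of_pos_right (Real.exp_pos v)).1 (hv ▸ hy)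

theorem mul_exp_lt_inv_exp_one : (0.278 : ℝ) * Real.exp 0.278 < 1 / Real.exp 1 := by
  have h_exp := Real.exp_bound' (x := 0.278) (by norm_num) (by norm_num) (n := 5) (by norm_num)
  norm_num [Finset.sum_range_succ, Nat.factorial] at h_exp ⊢
  rw [← one_div, lt_div_iff₀ (Real.exp_pos 1)]
  nlinarith [Real.exp_one_lt_d9, Real.exp_pos 1]

theorem inv_exp_one_lt_mul_exp : 1 / Real.exp 1 < (0.279 : ℝ) * Real.exp 0.279 := by
  have h_exp := Real.sum_le_exp_of_nonneg (x := 0.279) (by norm_num) 5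
  norm_num [Finset.sum_range_succ, Nat.factorial] at h_exp ⊢
  rw [← one_div, div_lt_iff₀ (Real.exp_pos 1)]
  nlinarith [Real.exp_one_gt_d9, Real.exp_pos 1]

theorem mem_Ioo_of_mul_exp_eq {w : ℝ} (hw : w * Real.exp w = 1 / Real.exp 1) :
    w ∈ Set.Ioo 0.278 0.279 := by
  have hw_nonneg : 0 ≤ w := (pos_of_mul_exp_eq hw).le
  constructor
  · refine (strictMonoOn_mul_exp.lt_iff_lt (by norm_num) hw_nonneg).1 ?_
    simpa only [hw] using mul_exp_lt_inv_exp_one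
  · refine (strictMonoOn_mul_exp.lt_iff_lt hw_nonneg (by norm_num)).1 ?_
    simpa only [hw] using inv_exp_one_lt_mul_exp

end Lambert

theorem le_ofReal_mul_sum_of_forall_pos {ι : Type*} [Fintype ι] {B : ℝ≥0∞} {r : ι → ℝ≥0∞} {C : ℝ}
    (hC : 0 < C) (h : ∀ a : ι → ℝ≥0, (∀ i, 0 < a i) → (∀ i, r i ≤ a i) →
      B ≤ ENNReal.ofReal C * ∑ i, (a i : ℝ≥0∞)) :
    B ≤ ENNReal.ofReal C * ∑ i, r i := by
  by_cases h_top : ∑ i, r i = ∞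
  · rw [h_top, ENNReal.mul_top (ENNReal.ofReal_pos.2 hC).ne']
    exact le_top
  lift r to ι → ℝ≥0 using fun i => ENNReal.sum_ne_top.1 h_top i (Finset.mem_univ i)
  have h_cont : Continuous fun ε : ℝ≥0 => ENNReal.ofReal C * ∑ i, ((r i + ε : ℝ≥0) : ℝ≥0∞) :=
    (ENNReal.continuous_const_mul ENNReal.ofReal_ne_top).comp <|
      continuous_finsetSum _ fun i _ => ENNReal.continuous_coe.comp (by fun_prop)
  have h_lim := (h_cont.tendsto 0).mono_left (nhdsWithin_le_nhds (s := Set.Ioi 0))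
  simp only [add_zero] at h_lim
  exact ge_of_tendsto h_lim <| eventually_nhdsWithin_of_forall fun ε hε =>
    h (fun i => r i + ε) (fun i => add_pos_of_nonneg_of_pos zero_le hε) fun i => by simp

theorem BRev_le_of_forall_hasWeakL1Bound {k : ℕ} (μ : Measure (Fin k → ℝ≥0)) [IsFiniteMeasure μ]
    {C : ℝ} (hC : 0 < C) (h : ∀ a : Fin k → ℝ, (∀ i, 0 < a i) →
      (∀ i, HasWeakL1Bound (fun x : Fin k → ℝ≥0 => (x i : ℝ)) (a i) μ) →
      HasWeakL1Bound (fun x : Fin k → ℝ≥0 => ∑ i, (x i : ℝ)) (C * ∑ i, a i) μ) :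
    BRev μ ≤ ENNReal.ofReal C * ∑ i, Rev₁ (μ.map fun x => x i) := by
  simp_rw [BRev_eq_Rev₁_map_sum, Rev₁_eq_postedRev]
  refine le_ofReal_mul_sum_of_forall_pos hC fun a ha h_le => ?_
  rw [← ENNReal.ofNNReal_finsetSum, ENNReal.ofReal, ← ENNReal.coe_mul,
    postedRev_map_le_iff measurable_sum_coord]
  simpa [hC.le] using h (fun i => a i) ha fun i =>
    (postedRev_map_le_iff (measurable_pi_apply i)).1 (h_le i)

theorem BRev_pi_two_le {w : ℝ} (hw : w * Real.exp w = 1 / Real.exp 1) (F : Fin 2 → Measure ℝ≥0)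
    [∀ i, IsProbabilityMeasure (F i)] :
    BRev (.pi F) ≤ ENNReal.ofReal (w + 1) * (Rev₁ (F 0) + Rev₁ (F 1)) := by
  have hw_pos : 0 < w := pos_of_mul_exp_eq hw
  have h_meas (i : Fin 2) : Measurable fun x : Fin 2 → ℝ≥0 => (x i : ℝ) := by fun_prop
  have h_indep := ProbabilityTheory.iIndepFun_pi (μ := F) (X := fun _ (v : ℝ≥0) => (v : ℝ))
    fun _ => by fun_prop
  have h_bound := BRev_le_of_forall_hasWeakL1Bound (.pi F) (C := w + 1) (by positivity)
    fun a ha h => by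
      simpa only [Fin.sum_univ_two] using (h 0).add_of_indepFun hw (h_meas 0) (h_meas 1)
        (h_indep.indepFun zero_ne_one) (h 1) (ha 0) (ha 1)
  simpa only [(measurePreserving_eval F _).map_eq, Fin.sum_univ_two] using h_bound

theorem one_add_two_mul_log_two_mul_le {x : ℝ} (hx : 2 ≤ x) :
    1 + 2 * Real.log (2 * x) ≤ 6 * Real.log x := by
  have h_log : Real.log 2 ≤ Real.log x := Real.log_le_log two_pos hx
  rw [Real.log_mul two_ne_zero (by positivity)]
  linarith [Real.log_two_gt_d9]

theorem BRev_le_log_mul_sum {k : ℕ} (hk : 2 ≤ k) (μ : Measure (Fin k → ℝ≥0))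
    [IsProbabilityMeasure μ] :
    BRev μ ≤ ENNReal.ofReal (6 * Real.log k) * ∑ i, Rev₁ (μ.map fun x => x i) := by
  have hk_real : (2 : ℝ) ≤ k := by exact_mod_cast hk
  have : Nonempty (Fin k) := ⟨⟨0, by lia⟩⟩
  refine BRev_le_of_forall_hasWeakL1Bound μ
    (mul_pos (by norm_num) (Real.log_pos (by linarith))) fun a ha h p hp => ?_
  have h_meas (i : Fin k) : AEMeasurable (fun x : Fin k → ℝ≥0 => (x i : ℝ)) μ :=
    (measurable_pi_apply i).coe_nnreal_real.aemeasurable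
  refine (HasWeakL1Bound.sum h_meas h p hp).trans ?_
  rw [Fintype.card_fin]
  exact mul_le_mul_of_nonneg_right (one_add_two_mul_log_two_mul_le hk_real)
    (Finset.sum_nonneg fun i _ => (ha i).le)

theorem mainTheorem10_general :
    (∃! w : ℝ, w * Real.exp w = 1 / Real.exp 1) ∧
    (∀ w : ℝ, w * Real.exp w = 1 / Real.exp 1 →
      (1.278 ≤ w + 1 ∧ w + 1 < 1.279) ∧
      ∀ F : Fin 2 → Measure ℝ≥0, (∀ i, IsProbabilityMeasure (F i)) →
        BRev (Measure.pi F) ≤ ENNReal.ofReal (w + 1) * (Rev₁ (F 0) + Rev₁ (F 1)) ∧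
        ENNReal.ofReal (w + 1) * (Rev₁ (F 0) + Rev₁ (F 1)) =
          ENNReal.ofReal (w + 1) * SRev (Measure.pi F)) ∧
    (∃ c : ℝ, 0 < c ∧ ∀ k : ℕ, 2 ≤ k →
      ∀ μ : Measure (Fin k → ℝ≥0), IsProbabilityMeasure μ →
        BRev μ ≤ ENNReal.ofReal (c * Real.log k) * ∑ i, Rev₁ (μ.map fun x => x i) ∧
        ENNReal.ofReal (c * Real.log k) * ∑ i, Rev₁ (μ.map fun x => x i) =
          ENNReal.ofReal (c * Real.log k) * SRev μ) := by
  refine ⟨existsUnique_mul_exp_eq (by positivity), fun w hw => ⟨?_, fun F _ => ?_⟩,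
    6, by norm_num, fun k hk μ _ => ⟨BRev_le_log_mul_sum hk μ, by rw [SRev_eq_sum_Rev₁]⟩⟩
  · have h_bounds := mem_Ioo_of_mul_exp_eq hw
    constructor <;> linarith [h_bounds.1, h_bounds.2]
  · refine ⟨BRev_pi_two_le hw F, ?_⟩
    simp only [SRev_eq_sum_Rev₁, (measurePreserving_eval F _).map_eq, Fin.sum_univ_two]

theorem mainTheorem10 :
    (∃! w : ℝ, w * Real.exp w = 1 / Real.exp 1) ∧
    (∀ w : ℝ, w * Real.exp w = 1 / Real.exp 1 →
      (1.278 ≤ w + 1 ∧ w + 1 < 1.279) ∧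
      ∀ F : Fin 2 → Measure ℝ≥0, (∀ i, IsProbabilityMeasure (F i)) →
        BRev (Measure.pi F) ≤ ENNReal.ofReal (w + 1) * (Rev₁ (F 0) + Rev₁ (F 1)) ∧
        ENNReal.ofReal (w + 1) * (Rev₁ (F 0) + Rev₁ (F 1)) =
          ENNReal.ofReal (w + 1) * SRev (Measure.pi F)) ∧
    (∃ c : ℝ, 0 < c ∧ ∀ k : ℕ, 2 ≤ k →
      ∀ F : Fin k → Measure ℝ≥0, (∀ i, IsProbabilityMeasure (F i)) →
        BRev (Measure.pi F) ≤ ENNReal.ofReal (c * Real.log k) * ∑ i, Rev₁ (F i) ∧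
        ENNReal.ofReal (c * Real.log k) * ∑ i, Rev₁ (F i) =
          ENNReal.ofReal (c * Real.log k) * SRev (Measure.pi F)) := by
  obtain ⟨h_unique, h_two, c, hc, h_log⟩ := mainTheorem10_general
  exact ⟨h_unique, h_two, c, hc, fun k hk F _ => by
    simpa only [(measurePreserving_eval F _).map_eq] using h_log k hk (.pi F) inferInstance⟩
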